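/- Let $d\ge 1$, let $\mathbb C^d$ carry its standard inner product $\langle\xi,\eta\rangle=\sum_j \xi_j\bar\eta_j$ and norm $\|\cdot\|$, and let $\mu_d$ be the Borel probability measure on $\mathbb C^d$ with density $\pi^{-d}e^{-\|\xi\|^2}$ with respect to $2d$-dimensional Lebesgue measure. For a Borel map $\varphi\colon\mathbb C^d\to\mathbb C^d$ let $\tilde C_\varphi$ be the operator $\tilde C_\varphi f=f\circ\varphi$ in $L^2(\mu_d)$ with domain $\mathcal D(\tilde C_\varphi)=\{f\in L^2(\mu_d): f\circ\varphi\in L^2(\mu_d)\}$; it is called well-defined if the $\mu_d$-a.e. class of $f\circ\varphi$ depends only on the $\mu_d$-a.e. class of $f$. For a selfadjoint operator $B$ on $\mathbb C^d$ with range $\mathcal R(B)$, let $B^{-1}\colon\mathcal R(B)\to\mathcal R(B)$ denote the generalized inverse: $B^{-1}b$ is the unique $c\in\mathcal R(B)$ with $Bc=b$. Suppose $\varphi\colon\mathbb C^d\to\mathbb C^d$ is holomorphic. Then the following two conditions are equivalent: (i) $\tilde C_\varphi$ is well-defined and $\mathcal D(\tilde C_\varphi)=L^2(\mu_d)$; (ii)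 there exist a linear operator $A$ on $\mathbb C^d$ and $b\in\mathbb C^d$ such that $\varphi(z)=Az+b$ for all $z\in\mathbb C^d$, $A$ is nonsingular, $\|A\|\le 1$ (operator norm) and $b\in\mathcal R(I-AA^*)$. Moreover, if (ii) holds with $A$ and $b$, then $\tilde C_\varphi$ is a bounded operator on the whole of $L^2(\mu_d)$, and its norm and spectral radius are given by $$\|\tilde C_\varphi\|^2=\frac{1}{|\det A|^2}\exp\big(\langle (I-AA^*)^{-1}b,b\rangle\big),\qquad r(\tilde C_\varphi)=\frac{1}{|\det A|}.$$ -/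

import Mathlib

open MeasureTheory

/-- The space `ℂ^d` with its standard inner product and Euclidean norm. -/
abbrev Cd (d : ℕ) : Type := EuclideanSpace ℂ (Fin d)

/-- The Gaussian measure `μ_d` on `ℂ^d`: density `π^{-d} exp(-‖ξ‖²)` with respect to the
`2d`-dimensional Lebesgue measure. -/
noncomputable def gaussCd (d : ℕ) : Measure (Cd d) :=
  (volume : Measure (Cd d)).withDensity
    (fun ξ => ENNReal.ofReal (1 / Real.pi ^ d * Real.exp (-‖ξ‖ ^ 2)))

/-- The complex Hilbert space `L²(μ_d)`. -/
abbrev L2Gauss (d : ℕ) : Type := Lp ℂ 2 (gaussCd d)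

/-- The graph of `f ↦ f ∘ φ` in `L²(μ_d)`: all pairs of classes `([f], [f ∘ φ])`, where `f` runs
over the Borel functions such that `f` and `f ∘ φ` are square integrable. In general this is only
a linear relation, since `[f ∘ φ]` may depend on the chosen representative `f`. -/
def compRel {d : ℕ} (φ : Cd d → Cd d) : Submodule ℂ (L2Gauss d × L2Gauss d) where
  carrier := {p | ∃ f : Cd d → ℂ, Measurable f ∧
    p.1 =ᵐ[gaussCd d] f ∧ p.2 =ᵐ[gaussCd d] f ∘ φ}
  add_mem' := by
    rintro p q ⟨f, hf, h1, h2⟩ ⟨g, hg, h3, h4⟩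
    exact ⟨f + g, hf.add hg, (Lp.coeFn_add p.1 q.1).trans (h1.add h3),
      (Lp.coeFn_add p.2 q.2).trans (h2.add h4)⟩
  zero_mem' := ⟨0, measurable_zero, Lp.coeFn_zero _ _ _, Lp.coeFn_zero _ _ _⟩
  smul_mem' := by
    rintro c p ⟨f, hf, h1, h2⟩
    exact ⟨c • f, hf.const_smul c, (Lp.coeFn_smul c p.1).trans (h1.const_smul c),
      (Lp.coeFn_smul c p.2).trans (h2.const_smul c)⟩

/-- The composition operator with symbol `φ` is well defined on classes: the class `[f ∘ φ]`
depends only on the class `[f]`. -/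
def CompWellDefined {d : ℕ} (φ : Cd d → Cd d) : Prop :=
  ∀ F G H : L2Gauss d, (F, G) ∈ compRel φ → (F, H) ∈ compRel φ → G = H

/-- The composition operator `f ↦ f ∘ φ` in `L²(μ_d)`, a partially defined linear operator whose
domain consists of the `f` in `L²(μ_d)` with `f ∘ φ` in `L²(μ_d)`. It is the operator with graph
`compRel φ` when it is well defined (and has a junk value otherwise). -/
noncomputable def compOp {d : ℕ} (φ : Cd d → Cd d) : L2Gauss d →ₗ.[ℂ] L2Gauss d :=
  (compRel φ).toLinearPMap

/-- The generalized inverse of a selfadjoint operator `B`: for `b` in the range of `B`,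
`genInv B b` is the unique vector `c` in the closure of the range of `B` with `B c = b`
(and `0` if there is no such vector). -/
noncomputable def genInv {H : Type*} [NormedAddCommGroup H] [InnerProductSpace ℂ H]
    (B : H →L[ℂ] H) (b : H) : H :=
  open Classical in
  if h : ∃ c ∈ closure (Set.range B), B c = b then h.choose else 0

/-- `I - A A^*` on `ℂ^d`. -/
noncomputable def defectOp {d : ℕ} (A : Cd d →L[ℂ] Cd d) : Cd d →L[ℂ] Cd d :=
  1 - A * ContinuousLinearMap.adjoint A

/-- `φ = A + b` with `A` nonsingular, `‖A‖ ≤ 1` and `b` in the range of `I - A A^*`. -/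
def IsContractiveAffine {d : ℕ} (φ : Cd d → Cd d) (A : Cd d →L[ℂ] Cd d) (b : Cd d) : Prop :=
  (∀ z, φ z = A z + b) ∧ A.det ≠ 0 ∧ ‖A‖ ≤ 1 ∧ b ∈ Set.range (defectOp A)

/-! Composition with `φ` is bounded on L²(μ) exactly when the image of μ under `φ` is dominated by a
multiple of μ, and the best multiple is the squared norm. Well-definedness says that the image is
absolutely continuous; an everywhere defined operator is then bounded by the closed graph theorem
(`exists_isCompositionBy_of_domain_eq_top`).

Testing the domination on exponentials, together with the mean value property, gives ‖φ ζ‖² ≤ ‖ζ‖² +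
K (`exists_norm_sq_le_of_map_le`). A Liouville argument makes `φ` affine, and the same bound forces
‖A‖ ≤ 1 and b ⊥ ker(I - AA*), which is the range condition. A singular `A` would have a null image.

Conversely, for affine `φ` the image measure has density |det A|⁻² exp(‖φ z‖² - ‖z‖²) at the point φ
z. With b = (I - AA*)c, completing the square (`norm_affine_sq_sub_norm_sq`) shows that the exponent
has maximum ⟨b, c⟩, attained at z = A*c; this is the norm formula.

The spectral radius comes from Gelfand's formula, powers of the operator being compositions with
iterates of `φ`. The determinant contributes |det A|⁻ⁿ, and the exponential factor stays bounded
along a subsequence (`exists_norm_iterate_sq_le`). -/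

/-! ### The Gaussian measure: translations, rotations, mean values, affine substitutions. -/

lemma measurable_gaussDensity (d : ℕ) :
    Measurable (fun ξ : Cd d => ENNReal.ofReal (1 / Real.pi ^ d * Real.exp (-‖ξ‖ ^ 2))) := by
  fun_prop

lemma lintegral_gaussCd {d : ℕ} {F : Cd d → ENNReal} (hF : Measurable F) :
    ∫⁻ z, F z ∂gaussCd d =
      ∫⁻ z, ENNReal.ofReal (1 / Real.pi ^ d * Real.exp (-‖z‖ ^ 2)) * F z := by
  rw [gaussCd, lintegral_withDensity_eq_lintegral_mul _ (measurable_gaussDensity d) hF]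
  rfl

lemma gaussCd_absolutelyContinuous (d : ℕ) : gaussCd d ≪ (volume : Measure (Cd d)) :=
  withDensity_absolutelyContinuous _ _

lemma volume_absolutelyContinuous_gaussCd (d : ℕ) : (volume : Measure (Cd d)) ≪ gaussCd d := by
  refine withDensity_absolutelyContinuous' (measurable_gaussDensity d).aemeasurable ?_
  filter_upwards with z
  have : 0 < 1 / Real.pi ^ d * Real.exp (-‖z‖ ^ 2) := by positivity
  simpa using this

instance isOpenPosMeasure_gaussCd (d : ℕ) : (gaussCd d).IsOpenPosMeasure :=
  (volume_absolutelyContinuous_gaussCd d).isOpenPosMeasure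

lemma finrank_real_Cd (d : ℕ) : Module.finrank ℝ (Cd d) = 2 * d := by
  rw [← Module.finrank_mul_finrank ℝ ℂ (Cd d)]
  simp

instance isProbabilityMeasure_gaussCd (d : ℕ) : IsProbabilityMeasure (gaussCd d) := by
  constructor
  have h := GaussianFourier.integral_rexp_neg_mul_sq_norm (V := Cd d) (b := 1) one_pos
  rw [finrank_real_Cd] at h
  have h' : ∫ z : Cd d, Real.exp (-‖z‖ ^ 2) = Real.pi ^ d := by
    simpa using h
  -- A non-integrable function would have integral `0` by convention, but this integral is positive.
  have hi : Integrable (fun z : Cd d => Real.exp (-‖z‖ ^ 2)) := by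
    by_contra hn
    rw [integral_undef hn] at h'
    exact (pow_pos Real.pi_pos d).ne h'
  rw [gaussCd, withDensity_apply _ MeasurableSet.univ, setLIntegral_univ,
    ← ofReal_integral_eq_lintegral_ofReal (hi.const_mul _)
      (Filter.Eventually.of_forall fun z => by positivity),
    integral_const_mul, h', one_div, inv_mul_cancel₀ (pow_pos Real.pi_pos d).ne', ENNReal.ofReal_one]

/-- Translation formula for the Gaussian measure. -/
lemma lintegral_gaussCd_add {d : ℕ} {F : Cd d → ENNReal} (hF : Measurable F) (ζ : Cd d) :
    ∫⁻ z, F (ζ + z) * ENNReal.ofReal (Real.exp (-2 * (inner ℂ ζ z).re)) ∂gaussCd d =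
      ENNReal.ofReal (Real.exp (‖ζ‖ ^ 2)) * ∫⁻ z, F z ∂gaussCd d := by
  rw [lintegral_gaussCd (by fun_prop), lintegral_gaussCd hF, ← lintegral_const_mul _ (by fun_prop),
    ← lintegral_add_left_eq_self (fun z => _ * (ENNReal.ofReal _ * F z)) ζ]
  refine lintegral_congr fun z => ?_
  have key : 1 / Real.pi ^ d * Real.exp (-‖z‖ ^ 2) * Real.exp (-2 * (inner ℂ ζ z).re) =
      Real.exp (‖ζ‖ ^ 2) * (1 / Real.pi ^ d * Real.exp (-‖ζ + z‖ ^ 2)) := by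
    have h := norm_add_sq (𝕜 := ℂ) ζ z
    simp only [RCLike.re_to_complex] at h
    rw [h, mul_assoc, ← Real.exp_add, mul_left_comm, ← Real.exp_add]
    ring_nf
  rw [mul_comm (F _), ← mul_assoc, ← mul_assoc, ← ENNReal.ofReal_mul (by positivity),
    ← ENNReal.ofReal_mul (by positivity), key]

lemma lintegral_gaussCd_exp {d : ℕ} (a : Cd d) :
    ∫⁻ z, ENNReal.ofReal (Real.exp (2 * (inner ℂ a z).re)) ∂gaussCd d =
      ENNReal.ofReal (Real.exp (‖a‖ ^ 2)) := by
  simpa using lintegral_gaussCd_add (F := fun _ => 1) measurable_const (-a)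

lemma measurePreserving_smul_gaussCd (d : ℕ) {c : ℂ} (hc : ‖c‖ = 1) :
    MeasurePreserving (fun z : Cd d => c • z) (gaussCd d) (gaussCd d) := by
  have hc0 : c ≠ 0 := by rintro rfl; simp at hc
  let e : Cd d ≃ₗᵢ[ℝ] Cd d :=
    { (LinearEquiv.smulOfNeZero ℂ (Cd d) c hc0).restrictScalars ℝ with
      norm_map' := fun z => by
        change ‖c • z‖ = ‖z‖
        rw [norm_smul, hc, one_mul] }
  have he : MeasurePreserving (fun z : Cd d => c • z) volume volume := e.measurePreserving
  refine ⟨measurable_const_smul c, Measure.ext_of_lintegral _ fun F hF => ?_⟩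
  have hm : Measurable fun z : Cd d =>
    ENNReal.ofReal (1 / Real.pi ^ d * Real.exp (-‖z‖ ^ 2)) * F z := by fun_prop
  rw [lintegral_map hF (measurable_const_smul c), lintegral_gaussCd (F := fun z => F (c • z))
      (hF.comp (measurable_const_smul c)),
    lintegral_gaussCd hF, ← he.lintegral_comp hm]
  simp [norm_smul, hc]

/-- Mean value inequality for entire functions and the Gaussian measure. -/
lemma enorm_apply_zero_le_lintegral_gaussCd {d : ℕ} {H : Cd d → ℂ} (hH : Differentiable ℂ H) :
    ‖H 0‖ₑ ≤ ∫⁻ z, ‖H z‖ₑ ∂gaussCd d := by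
  have hpt : ∀ z : Cd d, ‖H 0‖ₑ ≤ ENNReal.ofReal (2 * Real.pi)⁻¹ *
      ∫⁻ θ in Set.Ioc 0 (2 * Real.pi), ‖H (circleMap 0 1 θ • z)‖ₑ := by
    intro z
    -- One-variable mean value property on the complex line through `z`; averaging over `z` and
    -- rotation invariance then remove the angle.
    have hd : Differentiable ℂ fun t : ℂ => H (t • z) :=
      hH.comp (differentiable_id.smul_const z)
    have h := (hd.diffContOnCl (s := Metric.ball 0 |1|)).circleAverage
    rw [zero_smul, Real.circleAverage_def, intervalIntegral.integral_of_le (by positivity)] at h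
    rw [← h, enorm_smul]
    gcongr
    · rw [Real.enorm_eq_ofReal (by positivity)]
    · exact enorm_integral_le_lintegral_enorm _
  calc ‖H 0‖ₑ = ∫⁻ _, ‖H 0‖ₑ ∂gaussCd d := by simp
    _ ≤ ∫⁻ z, (ENNReal.ofReal (2 * Real.pi)⁻¹ *
      ∫⁻ θ in Set.Ioc 0 (2 * Real.pi), ‖H (circleMap 0 1 θ • z)‖ₑ) ∂gaussCd d :=
        lintegral_mono hpt
    _ = ENNReal.ofReal (2 * Real.pi)⁻¹ * ∫⁻ θ in Set.Ioc 0 (2 * Real.pi),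
        ∫⁻ z, ‖H (circleMap 0 1 θ • z)‖ₑ ∂gaussCd d := by
      have hc : Continuous fun p : Cd d × ℝ => ‖H (circleMap 0 1 p.2 • p.1)‖ₑ := by
        have := hH.continuous
        have := continuous_circleMap 0 1
        fun_prop
      rw [lintegral_const_mul _ (hc.measurable.lintegral_prod_right),
        lintegral_lintegral_swap hc.measurable.aemeasurable]
    _ = ENNReal.ofReal (2 * Real.pi)⁻¹ * ∫⁻ θ in Set.Ioc 0 (2 * Real.pi),
        ∫⁻ z, ‖H z‖ₑ ∂gaussCd d := by
      congr 1
      refine lintegral_congr fun θ => ?_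
      exact (measurePreserving_smul_gaussCd d (c := circleMap 0 1 θ) (by simp)).lintegral_comp
        hH.continuous.enorm.measurable
    _ = ∫⁻ z, ‖H z‖ₑ ∂gaussCd d := by
      rw [setLIntegral_const, Real.volume_Ioc, mul_left_comm,
        ← ENNReal.ofReal_mul (inv_nonneg.2 Real.two_pi_pos.le), sub_zero,
        inv_mul_cancel₀ Real.two_pi_pos.ne', ENNReal.ofReal_one, mul_one]

lemma map_affine_volume {d : ℕ} {A : Cd d →L[ℂ] Cd d} (hA : A.det ≠ 0) (b : Cd d) :
    Measure.map (fun z => A z + b) (volume : Measure (Cd d)) =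
      ENNReal.ofReal (1 / ‖A.det‖ ^ 2) • volume := by
  let f : Cd d →ₗ[ℝ] Cd d := (A : Cd d →ₗ[ℂ] Cd d).restrictScalars ℝ
  have hf : LinearMap.det f = ‖A.det‖ ^ 2 := by
    rw [LinearMap.det_restrictScalars, Algebra.norm_complex_eq]
    exact Complex.normSq_eq_norm_sq _
  have hm := Measure.map_linearMap_addHaar_eq_smul_addHaar (volume : Measure (Cd d)) (f := f)
    (by rw [hf]; simpa using hA)
  have : (fun z => A z + b) = (fun z => z + b) ∘ f := rfl
  rw [this, ← Measure.map_map (g := fun z => z + b) (f := f) (measurable_add_const b)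
    A.continuous.measurable, hm,
    Measure.map_smul, map_add_right_eq_self, hf, abs_of_nonneg (by positivity), one_div]

/-- Change of variables for an affine map and the Gaussian measure. -/
lemma lintegral_gaussCd_affine {d : ℕ} {A : Cd d →L[ℂ] Cd d} (hA : A.det ≠ 0) (b : Cd d)
    {F : Cd d → ENNReal} (hF : Measurable F) :
    ∫⁻ z, F (A z + b) * ENNReal.ofReal (Real.exp (‖z‖ ^ 2 - ‖A z + b‖ ^ 2)) ∂gaussCd d =
      ENNReal.ofReal (1 / ‖A.det‖ ^ 2) * ∫⁻ z, F z ∂gaussCd d := by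
  have hm : Measurable fun z => A z + b := by fun_prop
  rw [lintegral_gaussCd (by fun_prop), lintegral_gaussCd hF, ← smul_eq_mul (a := ENNReal.ofReal _)
    (b := lintegral _ _), ← lintegral_smul_measure, ← map_affine_volume hA b,
    lintegral_map (by fun_prop) hm]
  refine lintegral_congr fun z => ?_
  rw [mul_comm (F _), ← mul_assoc, ← ENNReal.ofReal_mul (by positivity), mul_assoc, ← Real.exp_add]
  ring_nf

/-! ### Composition operators and domination of the image measure. -/

/-- The bounded operator `T` on `L²(μ_d)` is the composition operator with symbol `φ`. -/
def IsCompositionBy {d : ℕ} (T : L2Gauss d →L[ℂ] L2Gauss d) (φ : Cd d → Cd d) : Prop :=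
  ∀ f : L2Gauss d, T f =ᵐ[gaussCd d] f ∘ φ

lemma enorm_sq_eq_lintegral {d : ℕ} (f : L2Gauss d) :
    ‖f‖ₑ ^ 2 = ∫⁻ z, ‖f z‖ₑ ^ 2 ∂gaussCd d := by
  rw [Lp.enorm_def]
  have h := eLpNorm_nnreal_pow_eq_lintegral (f := f) (μ := gaussCd d) (p := 2) two_ne_zero
  have h2 := h
  norm_num at h2
  exact_mod_cast h2

lemma memLp_two_comp {d : ℕ} {φ : Cd d → Cd d} (hφ : Measurable φ) {c : ENNReal} (hc : c ≠ ⊤)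
    (hle : (gaussCd d).map φ ≤ c • gaussCd d) (f : L2Gauss d) : MemLp (f ∘ φ) 2 (gaussCd d) :=
  have h : MemLp f 2 ((gaussCd d).map φ) :=
    ((Lp.memLp f).smul_measure hc).mono_measure hle
  (memLp_map_measure_iff h.aestronglyMeasurable hφ.aemeasurable).1 h

lemma quasiMeasurePreserving_of_map_le {d : ℕ} {φ : Cd d → Cd d} (hφ : Measurable φ) {c : ENNReal}
    (hle : (gaussCd d).map φ ≤ c • gaussCd d) :
    Measure.QuasiMeasurePreserving φ (gaussCd d) (gaussCd d) :=
  ⟨hφ, Measure.absolutelyContinuous_of_le_smul hle⟩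

lemma lintegral_comp_le_of_map_le {d : ℕ} {φ : Cd d → Cd d} (hφ : Measurable φ) {c : ENNReal}
    (hle : (gaussCd d).map φ ≤ c • gaussCd d) {F : Cd d → ENNReal}
    (hF : AEMeasurable F (gaussCd d)) :
    ∫⁻ z, F (φ z) ∂gaussCd d ≤ c * ∫⁻ z, F z ∂gaussCd d := by
  have hF' : AEMeasurable F ((gaussCd d).map φ) :=
    hF.mono_ac (quasiMeasurePreserving_of_map_le hφ hle).absolutelyContinuous
  rw [← lintegral_map' hF' hφ.aemeasurable, ← smul_eq_mul, ← lintegral_smul_measure]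
  exact lintegral_mono' hle le_rfl

lemma IsCompositionBy.enorm_apply_sq {d : ℕ} {φ : Cd d → Cd d} {T : L2Gauss d →L[ℂ] L2Gauss d}
    (hT : IsCompositionBy T φ) (f : L2Gauss d) :
    ‖T f‖ₑ ^ 2 = ∫⁻ z, ‖f (φ z)‖ₑ ^ 2 ∂gaussCd d := by
  rw [enorm_sq_eq_lintegral]
  refine lintegral_congr_ae ?_
  filter_upwards [hT f] with z hz
  rw [hz, Function.comp_apply]

lemma norm_le_sqrt_mul_of_enorm_sq_le {E F : Type*} [NormedAddCommGroup E] [NormedAddCommGroup F]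
    {x : E} {y : F} {c : NNReal} (h : ‖x‖ₑ ^ 2 ≤ c * ‖y‖ₑ ^ 2) : ‖x‖ ≤ √c * ‖y‖ := by
  simp only [enorm_eq_nnnorm] at h
  have h2 : ‖x‖ ^ 2 ≤ c * ‖y‖ ^ 2 := by exact_mod_cast h
  refine abs_le_of_sq_le_sq' ?_ (by positivity) |>.2
  rwa [mul_pow, Real.sq_sqrt c.coe_nonneg]

/-- A symbol whose image measure is dominated by a multiple of the Gaussian measure induces a
bounded composition operator. -/
lemma exists_isCompositionBy {d : ℕ} {φ : Cd d → Cd d} (hφ : Measurable φ) {c : NNReal}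
    (hle : (gaussCd d).map φ ≤ (c : ENNReal) • gaussCd d) :
    ∃ T : L2Gauss d →L[ℂ] L2Gauss d, IsCompositionBy T φ := by
  have hq := quasiMeasurePreserving_of_map_le hφ hle
  have hm := memLp_two_comp hφ ENNReal.coe_ne_top hle
  obtain ⟨g, hg⟩ : ∃ g : L2Gauss d → L2Gauss d, ∀ f, g f =ᵐ[gaussCd d] f ∘ φ :=
    ⟨fun f => (hm f).toLp _, fun f => (hm f).coeFn_toLp⟩
  let T₀ : L2Gauss d →ₗ[ℂ] L2Gauss d :=
    { toFun := g
      map_add' := fun f₁ f₂ => Lp.ext <| (hg _).trans <|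
        (hq.ae_eq_comp (Lp.coeFn_add f₁ f₂)).trans <|
        ((hg f₁).add (hg f₂)).symm.trans (Lp.coeFn_add _ _).symm
      map_smul' := fun a f => Lp.ext <| (hg _).trans <|
        (hq.ae_eq_comp (Lp.coeFn_smul a f)).trans <|
        ((hg f).const_smul a).symm.trans (Lp.coeFn_smul _ _).symm }
  refine ⟨T₀.mkContinuous _ fun f => norm_le_sqrt_mul_of_enorm_sq_le (c := c) ?_, hg⟩
  rw [enorm_sq_eq_lintegral, enorm_sq_eq_lintegral]
  refine le_trans (le_of_eq (lintegral_congr_ae ?_)) (lintegral_comp_le_of_map_le hφ hle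
    ((Lp.aestronglyMeasurable f).enorm.pow_const 2))
  filter_upwards [hg f] with z hz
  change ‖g f z‖ₑ ^ 2 = _
  rw [hz, Function.comp_apply]

lemma IsCompositionBy.norm_sq_le {d : ℕ} {φ : Cd d → Cd d} (hφ : Measurable φ)
    {T : L2Gauss d →L[ℂ] L2Gauss d} (hT : IsCompositionBy T φ) {c : NNReal}
    (hle : (gaussCd d).map φ ≤ (c : ENNReal) • gaussCd d) : ‖T‖ ^ 2 ≤ c := by
  have : ‖T‖ ≤ √c := by
    refine T.opNorm_le_bound (Real.sqrt_nonneg _) fun f => norm_le_sqrt_mul_of_enorm_sq_le ?_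
    rw [hT.enorm_apply_sq, enorm_sq_eq_lintegral f]
    exact lintegral_comp_le_of_map_le hφ hle ((Lp.aestronglyMeasurable f).enorm.pow_const 2)
  exact (Real.le_sqrt (norm_nonneg _) c.coe_nonneg).1 this

/-- The indicator of a measurable set as an element of `L²(μ_d)`. -/
noncomputable def indicatorL2 {d : ℕ} {E : Set (Cd d)} (hE : MeasurableSet E) : L2Gauss d :=
  indicatorConstLp 2 hE (measure_ne_top (gaussCd d) E) (1 : ℂ)

lemma enorm_indicator_one_sq {d : ℕ} (E : Set (Cd d)) (z : Cd d) :
    ‖E.indicator (fun _ => (1 : ℂ)) z‖ₑ ^ 2 = E.indicator 1 z := by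
  by_cases hz : z ∈ E <;> simp [hz]

lemma measurable_indicator_one {d : ℕ} {E : Set (Cd d)} (hE : MeasurableSet E) :
    Measurable (E.indicator fun _ => (1 : ℂ)) :=
  measurable_const.indicator hE

lemma coeFn_indicatorL2 {d : ℕ} {E : Set (Cd d)} (hE : MeasurableSet E) :
    indicatorL2 hE =ᵐ[gaussCd d] E.indicator fun _ => (1 : ℂ) :=
  indicatorConstLp_coeFn

lemma enorm_indicatorL2_sq {d : ℕ} {E : Set (Cd d)} (hE : MeasurableSet E) :
    ‖indicatorL2 hE‖ₑ ^ 2 = gaussCd d E := by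
  rw [enorm_sq_eq_lintegral, ← lintegral_indicator_one hE]
  refine lintegral_congr_ae ?_
  filter_upwards [coeFn_indicatorL2 hE] with z hz
  rw [hz, enorm_indicator_one_sq]

/-- A well defined composition operator has an absolutely continuous symbol. -/
lemma quasiMeasurePreserving_of_compWellDefined {d : ℕ} {φ : Cd d → Cd d} (hφ : Measurable φ)
    (hw : CompWellDefined φ) : Measure.QuasiMeasurePreserving φ (gaussCd d) (gaussCd d) := by
  refine ⟨hφ, Measure.AbsolutelyContinuous.mk fun E hE h0 => ?_⟩
  rw [Measure.map_apply hφ hE]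
  have hE' : MeasurableSet (φ ⁻¹' E) := hφ hE
  -- The indicator of a null set `E` represents `0`, so its composition with `φ` must represent `0`
  -- too.
  have h1 : ((0 : L2Gauss d), indicatorL2 hE') ∈ compRel φ := by
    refine ⟨E.indicator fun _ => 1, measurable_indicator_one hE, ?_, coeFn_indicatorL2 hE'⟩
    refine (Lp.coeFn_zero ℂ 2 (gaussCd d)).trans (indicator_meas_zero h0).symm
  have h := hw _ _ _ h1 (zero_mem (compRel φ))
  rw [← enorm_indicatorL2_sq hE', h]
  simp

/-- Test on indicators: the squared norm of the image of 1_E is the mass of φ⁻¹(E). -/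
lemma IsCompositionBy.map_le {d : ℕ} {φ : Cd d → Cd d} (hφ : Measurable φ)
    (hq : Measure.QuasiMeasurePreserving φ (gaussCd d) (gaussCd d))
    {T : L2Gauss d →L[ℂ] L2Gauss d} (hT : IsCompositionBy T φ) :
    (gaussCd d).map φ ≤ ENNReal.ofReal (‖T‖ ^ 2) • gaussCd d := by
  refine Measure.le_iff.2 fun E hE => ?_
  have h2 : ‖T (indicatorL2 hE)‖ₑ ^ 2 = (gaussCd d).map φ E := by
    rw [hT.enorm_apply_sq, Measure.map_apply hφ hE, ← lintegral_indicator_one (hφ hE)]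
    refine lintegral_congr_ae ?_
    filter_upwards [hq.ae_eq_comp (coeFn_indicatorL2 hE)] with z hz
    simp only [Function.comp_apply] at hz
    rw [hz, enorm_indicator_one_sq]
    rfl
  rw [← h2, Measure.smul_apply, ← enorm_indicatorL2_sq hE, smul_eq_mul, ENNReal.ofReal_pow (norm_nonneg _),
    ofReal_norm, ← mul_pow]
  gcongr
  exact T.le_opENorm _

lemma mem_compRel_iff {d : ℕ} {φ : Cd d → Cd d}
    (hq : Measure.QuasiMeasurePreserving φ (gaussCd d) (gaussCd d)) (F G : L2Gauss d) :
    (F, G) ∈ compRel φ ↔ G =ᵐ[gaussCd d] F ∘ φ := by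
  constructor
  · rintro ⟨f, -, h1, h2⟩
    exact h2.trans (hq.ae_eq_comp h1.symm)
  · intro h
    have hs := Lp.aestronglyMeasurable F
    exact ⟨hs.mk F, hs.stronglyMeasurable_mk.measurable, hs.ae_eq_mk,
      h.trans (hq.ae_eq_comp hs.ae_eq_mk)⟩

lemma compWellDefined_of_quasiMeasurePreserving {d : ℕ} {φ : Cd d → Cd d}
    (hq : Measure.QuasiMeasurePreserving φ (gaussCd d) (gaussCd d)) : CompWellDefined φ := by
  intro F G H h1 h2
  rw [mem_compRel_iff hq] at h1 h2
  exact Lp.ext (h1.trans h2.symm)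

lemma CompWellDefined.graph_compOp {d : ℕ} {φ : Cd d → Cd d} (hw : CompWellDefined φ) :
    (compOp φ).graph = compRel φ := by
  refine Submodule.toLinearPMap_graph_eq _ ?_
  rintro ⟨F, G⟩ h (rfl : F = 0)
  exact hw _ _ _ h (zero_mem (compRel φ))

lemma IsCompositionBy.toPMap_eq {d : ℕ} {φ : Cd d → Cd d}
    (hq : Measure.QuasiMeasurePreserving φ (gaussCd d) (gaussCd d))
    {T : L2Gauss d →L[ℂ] L2Gauss d} (hT : IsCompositionBy T φ) :
    (T : L2Gauss d →ₗ[ℂ] L2Gauss d).toPMap ⊤ = compOp φ := by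
  refine LinearPMap.eq_of_eq_graph ?_
  rw [(compWellDefined_of_quasiMeasurePreserving hq).graph_compOp]
  ext ⟨F, G⟩
  rw [mem_compRel_iff hq, LinearPMap.mem_graph_iff]
  constructor
  · rintro ⟨y, h1, h2⟩
    simp only at h1 h2
    rw [← h2, ← h1]
    exact hT _
  · intro h
    exact ⟨⟨F, trivial⟩, rfl, Lp.ext ((hT F).trans h.symm)⟩

/-- An everywhere defined composition operator is bounded, by the closed graph theorem. -/
lemma exists_isCompositionBy_of_domain_eq_top {d : ℕ} {φ : Cd d → Cd d}
    (hq : Measure.QuasiMeasurePreserving φ (gaussCd d) (gaussCd d))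
    (hd : (compOp φ).domain = ⊤) : ∃ T : L2Gauss d →L[ℂ] L2Gauss d, IsCompositionBy T φ := by
  have hw := compWellDefined_of_quasiMeasurePreserving hq
  let g : L2Gauss d →ₗ[ℂ] L2Gauss d :=
    (compOp φ).toFun ∘ₗ (LinearEquiv.ofTop _ hd).symm.toLinearMap
  have hg : ∀ F, (g F : L2Gauss d) =ᵐ[gaussCd d] F ∘ φ := by
    intro F
    rw [← mem_compRel_iff hq, ← hw.graph_compOp, LinearPMap.mem_graph_iff]
    exact ⟨_, rfl, rfl⟩
  have hgraph : ∀ p : L2Gauss d × L2Gauss d, p ∈ g.graph ↔ p.2 =ᵐ[gaussCd d] p.1 ∘ φ := by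
    intro p
    rw [LinearMap.mem_graph_iff]
    constructor
    · intro h
      rw [h]
      exact hg _
    · intro h
      exact Lp.ext (h.trans (hg _).symm)
  have hcl : IsClosed (g.graph : Set (L2Gauss d × L2Gauss d)) := by
    refine isClosed_of_closure_subset fun p hp => ?_
    obtain ⟨u, hu, hlim⟩ := mem_closure_iff_seq_limit.1 hp
    have h1 : Filter.Tendsto (fun n => (u n).1) Filter.atTop (nhds p.1) :=
      (continuous_fst.tendsto p).comp hlim
    have h2 : Filter.Tendsto (fun n => (u n).2) Filter.atTop (nhds p.2) :=
      (continuous_snd.tendsto p).comp hlim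
    -- L² convergence gives a.e. convergence only along subsequences, so the second is extracted
    -- from the first.
    obtain ⟨ns, hns, hae1⟩ := (tendstoInMeasure_of_tendsto_Lp h1).exists_seq_tendsto_ae
    obtain ⟨ms, hms, hae2⟩ := (tendstoInMeasure_of_tendsto_Lp
      (h2.comp hns.tendsto_atTop)).exists_seq_tendsto_ae
    refine (hgraph p).2 ?_
    have hall : ∀ᵐ z ∂gaussCd d, ∀ n, (u n).2 z = (u n).1 (φ z) :=
      ae_all_iff.2 fun n => (hgraph (u n)).1 (hu n)
    filter_upwards [hq.ae hae1, hae2, hall] with z hz1 hz2 hz3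
    have := hz1.comp hms.tendsto_atTop
    refine tendsto_nhds_unique hz2 (this.congr fun n => ?_)
    simp [hz3]
  exact ⟨⟨g, g.continuous_of_isClosed_graph hcl⟩, hg⟩

/-! ### Growth of the symbol and affinity. -/

/-- If composition with an entire map is bounded on `L²(μ_d)`, then the map has growth
`‖φ ζ‖² ≤ ‖ζ‖² + K`. -/
lemma exists_norm_sq_le_of_map_le {d : ℕ} {φ : Cd d → Cd d} (hφ : Differentiable ℂ φ) {c : ℝ}
    (hle : (gaussCd d).map φ ≤ ENNReal.ofReal c • gaussCd d) :
    ∃ K : ℝ, ∀ ζ, ‖φ ζ‖ ^ 2 ≤ ‖ζ‖ ^ 2 + K := by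
  have hm : Measurable φ := hφ.continuous.measurable
  have hφc := hφ.continuous
  -- Enlarging the constant makes its logarithm meaningful.
  set C := max c 1 with hC
  have hC0 : 0 < C := lt_max_of_lt_right one_pos
  have hle' : (gaussCd d).map φ ≤ ENNReal.ofReal C • gaussCd d :=
    hle.trans fun E => by
      simp only [Measure.smul_apply, smul_eq_mul]
      gcongr
      exact le_max_left _ _
  refine ⟨Real.log C, fun ζ => ?_⟩
  set a := φ ζ with ha
  -- The second term is the weight of the Gaussian translation by `ζ`. The mean value inequality
  -- becomes exp(2‖a‖²) ≤ exp(‖ζ‖²) · C · exp(‖a‖²), and taking logarithms gives the claim.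
  let H : Cd d → ℂ := fun z => Complex.exp (2 * inner ℂ a (φ (ζ + z)) - 2 * inner ℂ ζ z)
  have hH : Differentiable ℂ H := by
    have h1 : Differentiable ℂ fun z => inner ℂ a (φ (ζ + z)) :=
      (innerSL ℂ a).differentiable.comp (hφ.comp (differentiable_id.const_add ζ))
    have h2 : Differentiable ℂ fun z : Cd d => inner ℂ ζ z := (innerSL ℂ ζ).differentiable
    exact ((h1.const_mul 2).sub (h2.const_mul 2)).cexp
  have hHn : ∀ z, ‖H z‖ₑ = ENNReal.ofReal (Real.exp (2 * (inner ℂ a (φ (ζ + z))).re)) *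
      ENNReal.ofReal (Real.exp (-2 * (inner ℂ ζ z).re)) := by
    intro z
    rw [← ofReal_norm, Complex.norm_exp, ← ENNReal.ofReal_mul (by positivity), ← Real.exp_add]
    simp [sub_eq_add_neg]
  have h0 : ‖H 0‖ₑ = ENNReal.ofReal (Real.exp (2 * ‖a‖ ^ 2)) := by
    rw [hHn, add_zero, ← ha, inner_self_eq_norm_sq_to_K]
    simp [← Complex.ofReal_pow]
  have h1 := enorm_apply_zero_le_lintegral_gaussCd hH
  rw [h0] at h1
  simp_rw [hHn] at h1
  rw [lintegral_gaussCd_add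
    (F := fun z => ENNReal.ofReal (Real.exp (2 * (inner ℂ a (φ z)).re))) (by fun_prop)] at h1
  have h2 := lintegral_comp_le_of_map_le hm hle'
    (F := fun z => ENNReal.ofReal (Real.exp (2 * (inner ℂ a z).re))) (by fun_prop)
  rw [lintegral_gaussCd_exp] at h2
  have h3 := h1.trans (mul_le_mul_right h2 _)
  rw [← ENNReal.ofReal_mul hC0.le, ← ENNReal.ofReal_mul (by positivity),
    ENNReal.ofReal_le_ofReal_iff (by positivity), ← Real.exp_log hC0, ← Real.exp_add,
    ← Real.exp_add, Real.exp_le_exp] at h3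
  linarith

/-- An entire map of linear growth on the complex line is affine. -/
lemma Complex.apply_one_eq_of_linear_growth {F : Type*} [NormedAddCommGroup F] [NormedSpace ℂ F]
    [CompleteSpace F] {g : ℂ → F} (hg : Differentiable ℂ g) {a b : ℝ} (hgr : ∀ t, ‖g t‖ ≤ a * ‖t‖ + b) :
    g 1 = deriv g 0 + g 0 := by
  -- Cauchy's estimate on the circle of radius ‖t‖ + 1 about `t` turns linear growth into a uniform
  -- bound, and Liouville then makes the derivative constant.
  have hb : ∀ t, ‖deriv g t‖ ≤ 2 * |a| + |b| := by
    intro t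
    have hR : 0 < ‖t‖ + 1 := by positivity
    refine (Complex.norm_deriv_le_of_forall_mem_sphere_norm_le hR hg.diffContOnCl
      (C := (2 * |a| + |b|) * (‖t‖ + 1)) fun w hw => ?_).trans
      (by rw [mul_div_cancel_right₀ _ hR.ne'])
    have h1 : ‖w‖ ≤ 2 * ‖t‖ + 1 := by
      rw [mem_sphere_iff_norm] at hw
      have := norm_le_norm_add_norm_sub' w t
      linarith
    have h2 : a * ‖w‖ ≤ |a| * (2 * ‖t‖ + 1) := by
      gcongr
      exact le_abs_self a
    have h3 : 0 ≤ |b| * ‖t‖ := by positivity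
    nlinarith [hgr w, le_abs_self b, abs_nonneg a]
  have hd : Differentiable ℂ (deriv g) := hg.deriv
  have hc : ∀ t, deriv g t = deriv g 0 := fun t =>
    hd.apply_eq_apply_of_bounded ((isBounded_iff_forall_norm_le).2
      ⟨2 * |a| + |b|, by rintro _ ⟨w, rfl⟩; exact hb w⟩) t 0
  have h1 : ∀ t, HasDerivAt (fun t => g t - t • deriv g 0) 0 t := by
    intro t
    have h := (hg t).hasDerivAt.fun_sub ((hasDerivAt_id t).smul_const (deriv g 0))
    simpa [hc t] using h
  have h2 := is_const_of_deriv_eq_zero (fun t => (h1 t).differentiableAt) (fun t => (h1 t).deriv) 1 0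
  simp only [one_smul, zero_smul, sub_zero] at h2
  rw [← h2, add_sub_cancel]

/-- On each complex line through the origin the map grows linearly, hence is affine there, with
slope given by the derivative at the origin. -/
lemma exists_affine_of_norm_sq_le {E : Type*} [NormedAddCommGroup E] [NormedSpace ℂ E]
    [CompleteSpace E] {φ : E → E} (hφ : Differentiable ℂ φ) {K : ℝ} (hK : ∀ ζ, ‖φ ζ‖ ^ 2 ≤ ‖ζ‖ ^ 2 + K) :
    ∃ (A : E →L[ℂ] E) (b : E), ∀ z, φ z = A z + b := by
  refine ⟨fderiv ℂ φ 0, φ 0, fun z => ?_⟩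
  have hd : Differentiable ℂ fun t : ℂ => φ (t • z) := hφ.comp (differentiable_id.smul_const z)
  have hder : HasDerivAt (fun t : ℂ => φ (t • z)) (fderiv ℂ φ 0 z) 0 := by
    have h1 : HasFDerivAt φ (fderiv ℂ φ 0) ((0 : ℂ) • z) := by
      rw [zero_smul]
      exact (hφ 0).hasFDerivAt
    simpa [Function.comp_def] using h1.comp_hasDerivAt (0 : ℂ) ((hasDerivAt_id (0 : ℂ)).smul_const z)
  have h := Complex.apply_one_eq_of_linear_growth hd (a := ‖z‖) (b := √|K|) fun t => by
    refine abs_le_of_sq_le_sq' ?_ (by positivity) |>.2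
    have h1 := hK (t • z)
    rw [norm_smul] at h1
    have h2 : 0 ≤ ‖z‖ * ‖t‖ * √|K| := by positivity
    nlinarith [Real.sq_sqrt (abs_nonneg K), le_abs_self K]
  simpa [hder.deriv] using h

/-! ### Contractivity, the range condition and completing the square. -/

section Contraction

variable {E : Type*} [NormedAddCommGroup E] [InnerProductSpace ℂ E]

lemma norm_le_one_of_norm_sq_le {A : E →L[ℂ] E} {b : E} {K : ℝ}
    (hK : ∀ z, ‖A z + b‖ ^ 2 ≤ ‖z‖ ^ 2 + K) : ‖A‖ ≤ 1 := by
  refine A.opNorm_le_bound zero_le_one fun z => ?_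
  rw [one_mul]
  by_contra! hlt
  -- Chosen so that t(‖A z‖ - ‖z‖) exceeds by one the bound √|K| + ‖b‖ that the growth hypothesis
  -- imposes.
  set t : ℝ := (√|K| + ‖b‖ + 1) / (‖A z‖ - ‖z‖) with ht
  have hpos : 0 < ‖A z‖ - ‖z‖ := sub_pos.2 hlt
  have ht0 : 0 < t := by positivity
  have h1 : ‖A ((t : ℂ) • z) + b‖ ≤ t * ‖z‖ + √|K| := by
    refine abs_le_of_sq_le_sq' ?_ (by positivity) |>.2
    have h1 := hK ((t : ℂ) • z)
    rw [norm_smul, Complex.norm_real, Real.norm_of_nonneg ht0.le] at h1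
    have h2 : 0 ≤ t * ‖z‖ * √|K| := by positivity
    nlinarith [Real.sq_sqrt (abs_nonneg K), le_abs_self K]
  have h2 : t * ‖A z‖ ≤ ‖A ((t : ℂ) • z) + b‖ + ‖b‖ := by
    have := norm_sub_le (A ((t : ℂ) • z) + b) b
    have hs : ‖A ((t : ℂ) • z)‖ = t * ‖A z‖ := by
      rw [map_smul, norm_smul, Complex.norm_real, Real.norm_of_nonneg ht0.le]
    rwa [add_sub_cancel_right, hs] at this
  have h3 : t * (‖A z‖ - ‖z‖) = √|K| + ‖b‖ + 1 := by
    rw [ht, div_mul_cancel₀ _ hpos.ne']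
  linarith

variable [CompleteSpace E]

lemma norm_adjoint_apply_of_fixed {A : E →L[ℂ] E} {x : E}
    (hx : A (ContinuousLinearMap.adjoint A x) = x) :
    ‖ContinuousLinearMap.adjoint A x‖ ^ 2 = ‖x‖ ^ 2 := by
  have h : inner ℂ (ContinuousLinearMap.adjoint A x) (ContinuousLinearMap.adjoint A x) =
      inner ℂ x x := by
    rw [ContinuousLinearMap.adjoint_inner_left, hx]
  rw [inner_self_eq_norm_sq_to_K, inner_self_eq_norm_sq_to_K] at h
  exact_mod_cast h

/-- Along multiples of A*x the map `A` is isometric, so the quadratic terms cancel. The cross term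
with `b` is linear and bounded above, hence zero. -/
lemma inner_eq_zero_of_norm_sq_le {A : E →L[ℂ] E} {b : E} {K : ℝ}
    (hK : ∀ z, ‖A z + b‖ ^ 2 ≤ ‖z‖ ^ 2 + K) {x : E}
    (hx : A (ContinuousLinearMap.adjoint A x) = x) : inner ℂ x b = 0 := by
  by_contra hne
  set w : ℂ := inner ℂ x b with hw
  have hpos : 0 < ‖w‖ ^ 2 := by positivity
  have key : ∀ s : ℝ, 2 * s * ‖w‖ ^ 2 + ‖b‖ ^ 2 ≤ K := by
    intro s
    -- The factor `w` makes the cross term the real number s‖w‖².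
    have h1 := hK (((s : ℂ) * w) • ContinuousLinearMap.adjoint A x)
    rw [map_smul, hx, norm_smul, mul_pow, norm_adjoint_apply_of_fixed hx, ← mul_pow, ← norm_smul,
      norm_add_sq (𝕜 := ℂ), inner_smul_left, ← hw] at h1
    have h2 : (starRingEnd ℂ) ((s : ℂ) * w) * w = ((s * ‖w‖ ^ 2 : ℝ) : ℂ) := by
      rw [map_mul, Complex.conj_ofReal, mul_assoc, mul_comm _ w, Complex.mul_conj,
        Complex.normSq_eq_norm_sq]
      push_cast
      ring
    rw [h2] at h1
    simp only [RCLike.re_to_complex, Complex.ofReal_re] at h1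
    linarith
  have := key ((|K| + 1) / (2 * ‖w‖ ^ 2))
  have h3 : 2 * ((|K| + 1) / (2 * ‖w‖ ^ 2)) * ‖w‖ ^ 2 = |K| + 1 := by
    field_simp
  nlinarith [le_abs_self K, sq_nonneg ‖b‖]

lemma mem_range_of_isSelfAdjoint_of_inner_ker [FiniteDimensional ℂ E] {B : E →L[ℂ] E}
    (hB : ContinuousLinearMap.adjoint B = B)
    {b : E} (hb : ∀ x, B x = 0 → inner ℂ x b = 0) : b ∈ Set.range B := by
  have h1 : b ∈ (B : E →ₗ[ℂ] E).range := by
    rw [← Submodule.orthogonal_orthogonal (B : E →ₗ[ℂ] E).range,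
      ContinuousLinearMap.orthogonal_range, hB]
    exact fun x hx => hb x hx
  exact h1

/-- For `b = (I - A A^*) c`, the function `‖A z + b‖² - ‖z‖²` equals `⟨b, c⟩` up to the defect of
`A` at `z - A^* c`. -/
lemma norm_affine_sq_sub_norm_sq {A : E →L[ℂ] E} {b c : E}
    (hc : c - A (ContinuousLinearMap.adjoint A c) = b) (z : E) :
    ‖A z + b‖ ^ 2 - ‖z‖ ^ 2 = (‖c‖ ^ 2 - ‖ContinuousLinearMap.adjoint A c‖ ^ 2) -
      (‖z - ContinuousLinearMap.adjoint A c‖ ^ 2 -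
        ‖A (z - ContinuousLinearMap.adjoint A c)‖ ^ 2) := by
  set u := z - ContinuousLinearMap.adjoint A c with hu
  have h1 : A z + b = A u + c := by
    rw [hu, map_sub, ← hc]
    abel
  have h2 : z = u + ContinuousLinearMap.adjoint A c := by rw [hu, sub_add_cancel]
  have h3 : ‖z‖ ^ 2 = ‖u + ContinuousLinearMap.adjoint A c‖ ^ 2 := by rw [← h2]
  rw [h1, h3, norm_add_sq (𝕜 := ℂ), norm_add_sq (𝕜 := ℂ), ContinuousLinearMap.adjoint_inner_right]
  ring

lemma inner_eq_norm_sq_sub_norm_adjoint_sq {A : E →L[ℂ] E} {b c : E}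
    (hc : c - A (ContinuousLinearMap.adjoint A c) = b) :
    inner ℂ b c = ((‖c‖ ^ 2 - ‖ContinuousLinearMap.adjoint A c‖ ^ 2 : ℝ) : ℂ) := by
  rw [← hc, inner_sub_left, ← ContinuousLinearMap.adjoint_inner_right, inner_self_eq_norm_sq_to_K,
    inner_self_eq_norm_sq_to_K]
  push_cast
  rfl

end Contraction

/-! ### Iterates of a contractive affine map. -/

section ContractionIterates

variable {E : Type*} [NormedAddCommGroup E] [InnerProductSpace ℂ E]

lemma norm_apply_le_of_norm_le_one {A : E →L[ℂ] E} (hA : ‖A‖ ≤ 1) (u : E) : ‖A u‖ ≤ ‖u‖ := by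
  simpa using A.le_of_opNorm_le hA u

lemma norm_pow_le_one_of_norm_le_one {A : E →L[ℂ] E} (hA : ‖A‖ ≤ 1) (n : ℕ) : ‖A ^ n‖ ≤ 1 := by
  induction n with
  | zero => exact ContinuousLinearMap.norm_id_le
  | succ n ih =>
    rw [pow_succ]
    exact (norm_mul_le _ _).trans (mul_le_one₀ ih (norm_nonneg _) hA)

/-- A contraction preserves the norm of `u` exactly when `B^* B u = u`. -/
lemma adjoint_apply_eq_iff_norm_eq [CompleteSpace E] {B : E →L[ℂ] E} (hB : ‖B‖ ≤ 1) (u : E) :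
    ContinuousLinearMap.adjoint B (B u) = u ↔ ‖B u‖ = ‖u‖ := by
  constructor
  · intro h
    have h1 : inner ℂ (B u) (B u) = inner ℂ u u := by
      rw [← ContinuousLinearMap.adjoint_inner_left, h]
    rw [inner_self_eq_norm_sq_to_K, inner_self_eq_norm_sq_to_K] at h1
    exact (pow_left_inj₀ (norm_nonneg _) (norm_nonneg _) two_ne_zero).1 (by exact_mod_cast h1)
  · intro h
    rw [← sub_eq_zero, ← norm_eq_zero, ← sq_eq_zero_iff]
    refine le_antisymm ?_ (sq_nonneg _)
    have hB' : ‖ContinuousLinearMap.adjoint B‖ ≤ 1 := by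
      rwa [LinearIsometryEquiv.norm_map]
    have h2 : ‖ContinuousLinearMap.adjoint B (B u)‖ ≤ ‖u‖ :=
      (norm_apply_le_of_norm_le_one hB' _).trans h.le
    have h3 : RCLike.re (inner ℂ (B u) (B u)) = ‖B u‖ ^ 2 := inner_self_eq_norm_sq _
    -- ‖B*Bu - u‖² = ‖B*Bu‖² - 2‖Bu‖² + ‖u‖², which is at most 0 when ‖Bu‖ = ‖u‖.
    rw [norm_sub_sq (𝕜 := ℂ), ContinuousLinearMap.adjoint_inner_left, h3, h]
    nlinarith [norm_nonneg (ContinuousLinearMap.adjoint B (B u))]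

lemma iterate_affine {A : E →L[ℂ] E} {b : E} {φ : E → E} (hφ : ∀ z, φ z = A z + b) (n : ℕ)
    (x y : E) : φ^[n] (x + y) = (A ^ n) x + φ^[n] y := by
  induction n generalizing x y with
  | zero => simp
  | succ n ih =>
    have : φ (x + y) = A x + φ y := by rw [hφ, hφ, map_add, add_assoc]
    rw [Function.iterate_succ_apply, Function.iterate_succ_apply, this, ih, pow_succ]
    rfl

/-- A strict contraction estimate on a subspace on which `B` strictly decreases norms. -/
lemma exists_lt_one_norm_apply_le [FiniteDimensional ℂ E] {B : E →L[ℂ] E} {V : Submodule ℂ E}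
    (hV : ∀ y ∈ V, y ≠ 0 → ‖B y‖ < ‖y‖) :
    ∃ ρ : ℝ, 0 ≤ ρ ∧ ρ < 1 ∧ ∀ y ∈ V, ‖B y‖ ≤ ρ * ‖y‖ := by
  have : ProperSpace E := FiniteDimensional.proper ℂ E
  have hcomp : IsCompact ((V : Set E) ∩ Metric.sphere 0 1) :=
    (isCompact_sphere 0 1).inter_left V.closed_of_finiteDimensional
  obtain ⟨ρ, h0, h1, h2⟩ : ∃ ρ : ℝ, 0 ≤ ρ ∧ ρ < 1 ∧
      ∀ y ∈ (V : Set E) ∩ Metric.sphere 0 1, ‖B y‖ ≤ ρ := by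
    rcases ((V : Set E) ∩ Metric.sphere 0 1).eq_empty_or_nonempty with he | hne
    · exact ⟨0, le_rfl, one_pos, by simp [he]⟩
    · obtain ⟨y, ⟨hyV, hy1⟩, hmax⟩ := hcomp.exists_isMaxOn hne B.continuous.norm.continuousOn
      have hy1' : ‖y‖ = 1 := by simpa using hy1
      have hlt := hV y hyV (by rintro rfl; simp at hy1')
      exact ⟨‖B y‖, norm_nonneg _, hy1' ▸ hlt, fun x hx => hmax hx⟩
  refine ⟨ρ, h0, h1, fun y hy => ?_⟩
  rcases eq_or_ne y 0 with rfl | hy0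
  · simp
  have hn : 0 < ‖y‖ := norm_pos_iff.2 hy0
  have h3 := h2 (((‖y‖⁻¹ : ℝ) : ℂ) • y) ⟨V.smul_mem _ hy, by
    rw [mem_sphere_zero_iff_norm, norm_smul, Complex.norm_real, norm_inv, norm_norm,
      inv_mul_cancel₀ hn.ne']⟩
  rw [map_smul, norm_smul, Complex.norm_real, norm_inv, norm_norm, inv_mul_le_iff₀ hn] at h3
  linarith

variable [CompleteSpace E]

/-- The vectors whose norm is preserved by `A ^ n`. -/
noncomputable def isometricPart (A : E →L[ℂ] E) (n : ℕ) : Submodule ℂ E :=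
  LinearMap.ker (ContinuousLinearMap.adjoint (A ^ n) * A ^ n - 1 : E →L[ℂ] E).toLinearMap

lemma mem_isometricPart {A : E →L[ℂ] E} (hA : ‖A‖ ≤ 1) {n : ℕ} {u : E} :
    u ∈ isometricPart A n ↔ ‖(A ^ n) u‖ = ‖u‖ := by
  rw [← adjoint_apply_eq_iff_norm_eq (norm_pow_le_one_of_norm_le_one hA n), ← sub_eq_zero]
  rfl

lemma isometricPart_antitone {A : E →L[ℂ] E} (hA : ‖A‖ ≤ 1) : Antitone (isometricPart A) := by
  refine antitone_nat_of_succ_le fun n u hu => ?_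
  rw [mem_isometricPart hA] at hu ⊢
  refine le_antisymm (norm_apply_le_of_norm_le_one (norm_pow_le_one_of_norm_le_one hA n) u) ?_
  rw [← hu, pow_succ']
  exact norm_apply_le_of_norm_le_one hA _

variable [FiniteDimensional ℂ E]

/-- For a contraction `A`, the space splits off a subspace `M` which `A` maps isometrically onto
itself, with some power of `A` a strict contraction on the orthogonal complement. -/
lemma exists_isometric_splitting {A : E →L[ℂ] E} (hA : ‖A‖ ≤ 1) :
    ∃ (M : Submodule ℂ E) (N : ℕ), 0 < N ∧ (∀ u ∈ M, ‖A u‖ = ‖u‖) ∧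
      (∀ x ∈ M, ∃ x' ∈ M, A x' = x) ∧ (∀ u ∈ M, A u ∈ M) ∧
      ∃ ρ : ℝ, 0 ≤ ρ ∧ ρ < 1 ∧ ∀ y ∈ Mᗮ, ‖(A ^ N) y‖ ≤ ρ * ‖y‖ := by
  -- The subspaces on which Aⁿ is isometric decrease, so they stabilize in finite dimension; the
  -- stable one is `M`.
  obtain ⟨n, hn⟩ := IsArtinian.monotone_stabilizes
    (⟨fun n => OrderDual.toDual (isometricPart A n), fun i j hij =>
      isometricPart_antitone hA hij⟩ : ℕ →o (Submodule ℂ E)ᵒᵈ)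
  have hst : ∀ m, n ≤ m → isometricPart A m = isometricPart A n := fun m hm => (hn m hm).symm
  have hN : ∀ {u} m, n ≤ m → u ∈ isometricPart A n → ‖(A ^ m) u‖ = ‖u‖ := fun m hm hu => by
    rw [← hst m hm] at hu
    exact (mem_isometricPart hA).1 hu
  have hsucc : ∀ u, (A ^ (n + 1)) u = (A ^ n) (A u) := fun u => by rw [pow_succ]; rfl
  have hle := norm_pow_le_one_of_norm_le_one hA n
  have hiso : ∀ u ∈ isometricPart A n, ‖A u‖ = ‖u‖ := fun u hu => by
    refine le_antisymm (norm_apply_le_of_norm_le_one hA u) ?_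
    rw [← hN (n + 1) n.le_succ hu, hsucc]
    exact norm_apply_le_of_norm_le_one hle _
  have hinv : ∀ u ∈ isometricPart A n, A u ∈ isometricPart A n := fun u hu => by
    rw [mem_isometricPart hA, ← hsucc, hN (n + 1) n.le_succ hu, hiso u hu]
  -- The exponent n + 1 is positive even if n = 0. By stability, a vector of Mᗮ whose norm it
  -- preserves lies in `M` too, hence is zero.
  refine ⟨isometricPart A n, n + 1, n.succ_pos, hiso, fun x hx => ?_, hinv, ?_⟩
  · let R := (A : E →ₗ[ℂ] E).restrict hinv
    have hinj : Function.Injective R := by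
      refine (injective_iff_map_eq_zero R).2 fun u hu => ?_
      have h1 : A u = 0 := congrArg Subtype.val hu
      have h2 := hiso u u.2
      rw [h1, norm_zero] at h2
      exact Subtype.ext (norm_eq_zero.1 h2.symm)
    obtain ⟨x', hx'⟩ := LinearMap.injective_iff_surjective.1 hinj ⟨x, hx⟩
    exact ⟨x', x'.2, congrArg Subtype.val hx'⟩
  · refine exists_lt_one_norm_apply_le fun y hy hy0 => ?_
    refine lt_of_le_of_ne
      (norm_apply_le_of_norm_le_one (norm_pow_le_one_of_norm_le_one hA _) y) fun heq => hy0 ?_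
    have hyM : y ∈ isometricPart A n := by
      rw [← hst (n + 1) n.le_succ]
      exact (mem_isometricPart hA).2 heq
    exact inner_self_eq_zero.1 (Submodule.inner_right_of_mem_orthogonal hyM hy)

/-- Along the multiples of some positive `N`, the iterates of a contractive affine map with
`b` in the range of `I - A A^*` increase the squared norm by a bounded amount. -/
lemma exists_norm_iterate_sq_le {A : E →L[ℂ] E} (hA : ‖A‖ ≤ 1) {b c : E}
    (hc : c - A (ContinuousLinearMap.adjoint A c) = b) {φ : E → E} (hφ : ∀ z, φ z = A z + b) :
    ∃ (N : ℕ) (C : ℝ), 0 < N ∧ ∀ k z, ‖φ^[N * k] z‖ ^ 2 - ‖z‖ ^ 2 ≤ C := by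
  obtain ⟨M, N, hN, hiso, hsurj, hinv, ρ, hρ0, hρ1, hρ⟩ := exists_isometric_splitting hA
  have hadj : ∀ x ∈ M, ContinuousLinearMap.adjoint A x ∈ M ∧
      A (ContinuousLinearMap.adjoint A x) = x := by
    intro x hx
    obtain ⟨x', hx', rfl⟩ := hsurj x hx
    rw [(adjoint_apply_eq_iff_norm_eq hA x').2 (hiso x' hx')]
    exact ⟨hx', rfl⟩
  -- AA* is the identity on `M`, so I - AA* has range orthogonal to `M`.
  have hb : b ∈ Mᗮ := by
    refine (Submodule.mem_orthogonal _ _).2 fun x hx => ?_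
    rw [← hc, inner_sub_right, ← ContinuousLinearMap.adjoint_inner_left,
      ContinuousLinearMap.adjoint_inner_right, (hadj x hx).2, sub_self]
  have hφM : ∀ y ∈ Mᗮ, φ y ∈ Mᗮ := by
    intro y hy
    rw [hφ]
    refine add_mem ((Submodule.mem_orthogonal _ _).2 fun x hx => ?_) hb
    rw [← ContinuousLinearMap.adjoint_inner_left]
    exact Submodule.inner_right_of_mem_orthogonal (hadj x hx).1 hy
  have hφn : ∀ n, ∀ y ∈ Mᗮ, φ^[n] y ∈ Mᗮ := by
    intro n
    induction n with
    | zero => exact fun y hy => hy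
    | succ n ih =>
      intro y hy
      rw [Function.iterate_succ_apply]
      exact ih _ (hφM y hy)
  have hAn : ∀ n, ∀ x ∈ M, (A ^ n) x ∈ M ∧ ‖(A ^ n) x‖ = ‖x‖ := by
    intro n
    induction n with
    | zero => exact fun x hx => ⟨hx, rfl⟩
    | succ n ih =>
      intro x hx
      have hs : (A ^ (n + 1)) x = (A ^ n) (A x) := by rw [pow_succ]; rfl
      rw [hs]
      exact ⟨(ih _ (hinv x hx)).1, (ih _ (hinv x hx)).2.trans (hiso x hx)⟩
  -- For r ≥ D one has ρr + ‖φ^[N] 0‖ ≤ r, so `φ^[N]` preserves the ball of radius r in Mᗮ.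
  set D := ‖φ^[N] 0‖ / (1 - ρ) with hD
  have hρ' : 0 < 1 - ρ := sub_pos.2 hρ1
  have hD0 : 0 ≤ D := by positivity
  have hDe : (1 - ρ) * D = ‖φ^[N] 0‖ := by rw [hD, mul_div_cancel₀ _ hρ'.ne']
  have hmax : ∀ k, ∀ y ∈ Mᗮ, ‖φ^[N * k] y‖ ≤ max ‖y‖ D := by
    intro k
    induction k with
    | zero => exact fun y _ => le_max_left _ _
    | succ k ih =>
      intro y hy
      have h1 := iterate_affine hφ N (φ^[N * k] y) 0
      rw [add_zero] at h1
      rw [Nat.mul_succ, Nat.add_comm, Function.iterate_add_apply, h1]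
      have h2 := hρ _ (hφn (N * k) y hy)
      have h3 : ρ * ‖φ^[N * k] y‖ ≤ ρ * max ‖y‖ D := by
        gcongr
        exact ih y hy
      have h4 : (1 - ρ) * D ≤ (1 - ρ) * max ‖y‖ D := by
        gcongr
        exact le_max_right _ _
      have h5 := norm_add_le ((A ^ N) (φ^[N * k] y)) (φ^[N] 0)
      linarith
  refine ⟨N, D ^ 2, hN, fun k z => ?_⟩
  -- The component in `M` moves isometrically and cancels from the difference; only the one in Mᗮ
  -- matters.
  obtain ⟨x, hx, y, hy, rfl⟩ := Submodule.exists_add_mem_mem_orthogonal (K := M) z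
  have h1 : ‖(A ^ (N * k)) x + φ^[N * k] y‖ ^ 2 = ‖x‖ ^ 2 + ‖φ^[N * k] y‖ ^ 2 := by
    rw [norm_add_sq (𝕜 := ℂ), Submodule.inner_right_of_mem_orthogonal (hAn _ x hx).1
      (hφn _ y hy), (hAn _ x hx).2]
    simp
  have h2 : ‖x + y‖ ^ 2 = ‖x‖ ^ 2 + ‖y‖ ^ 2 := by
    rw [norm_add_sq (𝕜 := ℂ), Submodule.inner_right_of_mem_orthogonal hx hy]
    simp
  rw [iterate_affine hφ, h1, h2]
  have h3 := hmax k y hy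
  have h4 : (max ‖y‖ D) ^ 2 ≤ ‖y‖ ^ 2 + D ^ 2 := by
    rcases max_choice ‖y‖ D with h | h <;> rw [h] <;> nlinarith [sq_nonneg ‖y‖, sq_nonneg D]
  have h5 : ‖φ^[N * k] y‖ ^ 2 ≤ (max ‖y‖ D) ^ 2 := by gcongr
  linarith

end ContractionIterates

/-! ### Image of the Gaussian measure under an affine map. -/

section AffineSymbol

variable {d : ℕ} {φ : Cd d → Cd d} {A : Cd d →L[ℂ] Cd d} {b : Cd d}

lemma map_gaussCd_le_of_norm_sq_sub_le (hφ : ∀ z, φ z = A z + b) (hA : A.det ≠ 0) {s : ℝ}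
    (hs : ∀ z, ‖φ z‖ ^ 2 - ‖z‖ ^ 2 ≤ s) :
    (gaussCd d).map φ ≤ ENNReal.ofReal (1 / ‖A.det‖ ^ 2 * Real.exp s) • gaussCd d := by
  obtain rfl : φ = fun z => A z + b := funext hφ
  have hm : Measurable fun z => A z + b := by fun_prop
  refine Measure.le_iff.2 fun S hS => ?_
  have hF : Measurable (S.indicator (1 : Cd d → ENNReal)) := measurable_one.indicator hS
  rw [← lintegral_indicator_one hS, lintegral_map hF hm, Measure.smul_apply,
    ← lintegral_indicator_one hS, smul_eq_mul, mul_comm (1 / _), ENNReal.ofReal_mul (by positivity),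
    mul_assoc, ← lintegral_gaussCd_affine hA b hF, ← lintegral_const_mul _ (by fun_prop)]
  refine lintegral_mono fun z => ?_
  rw [mul_left_comm, ← ENNReal.ofReal_mul (by positivity), ← Real.exp_add]
  refine le_mul_of_one_le_right' ?_
  rw [ENNReal.one_le_ofReal, Real.one_le_exp_iff]
  linarith [hs z]

/-- The density of the image of the Gaussian measure under an affine map is a lower bound for any
dominating constant, at every point. -/
lemma exp_le_of_map_gaussCd_le (hφ : ∀ z, φ z = A z + b) (hA : A.det ≠ 0) {C : ℝ} (hC : 0 ≤ C)
    (hle : (gaussCd d).map φ ≤ ENNReal.ofReal C • gaussCd d) (z : Cd d) :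
    1 / ‖A.det‖ ^ 2 * Real.exp (‖φ z‖ ^ 2 - ‖z‖ ^ 2) ≤ C := by
  obtain rfl : φ = fun z => A z + b := funext hφ
  have hm : Measurable fun z => A z + b := by fun_prop
  let e := A.toContinuousLinearEquivOfDetNeZero hA
  let ψ : Cd d → Cd d := fun w => e.symm (w - b)
  have hψ : Measurable ψ := by fun_prop
  have hψφ : ∀ z, ψ (A z + b) = z := fun z => by
    simp only [ψ, add_sub_cancel_right]
    exact e.symm_apply_apply z
  have hdet : 0 < ‖A.det‖ ^ 2 := by positivity
  set g : Cd d → ℝ := fun z => C * ‖A.det‖ ^ 2 * Real.exp (‖z‖ ^ 2 - ‖A z + b‖ ^ 2) with hg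
  have hgc : Continuous g := by fun_prop
  -- Indicators of `S` pulled back by the inverse `ψ` localize the domination on the source side.
  -- Continuity of `g` then upgrades the a.e. bound to every point, an open null set being empty.
  have hae : (1 : Cd d → ENNReal) ≤ᵐ[gaussCd d] fun z => ENNReal.ofReal (g z) := by
    refine ae_le_of_forall_setLIntegral_le_of_sigmaFinite measurable_one fun S hS _ => ?_
    have hF : Measurable fun w => S.indicator (1 : Cd d → ENNReal) (ψ w) :=
      (measurable_one.indicator hS).comp hψ
    have h1 := lintegral_comp_le_of_map_le hm hle hF.aemeasurable
    have h2 := lintegral_gaussCd_affine hA b hF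
    simp only [hψφ] at h1 h2
    have h3 : ∫⁻ w, S.indicator (1 : Cd d → ENNReal) (ψ w) ∂gaussCd d =
        ENNReal.ofReal (‖A.det‖ ^ 2) * ∫⁻ z, S.indicator (1 : Cd d → ENNReal) z *
          ENNReal.ofReal (Real.exp (‖z‖ ^ 2 - ‖A z + b‖ ^ 2)) ∂gaussCd d := by
      rw [h2, ← mul_assoc, ← ENNReal.ofReal_mul (by positivity), mul_one_div_cancel hdet.ne',
        ENNReal.ofReal_one, one_mul]
    rw [h3, ← mul_assoc, ← ENNReal.ofReal_mul hC, ← lintegral_const_mul _ (by fun_prop)] at h1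
    rw [← lintegral_indicator hS, ← lintegral_indicator hS]
    refine h1.trans (lintegral_mono fun z => ?_)
    by_cases hz : z ∈ S
    · simp only [Set.indicator_of_mem hz, Pi.one_apply, one_mul]
      rw [← ENNReal.ofReal_mul (by positivity)]
    · simp [Set.indicator_of_notMem hz]
  have hall : ∀ z, 1 ≤ g z := by
    have hopen : IsOpen {z | g z < 1} := isOpen_lt hgc continuous_const
    have hnull : gaussCd d {z | g z < 1} = 0 := by
      refine measure_mono_null (fun z hz => ?_) (ae_iff.1 hae)
      simpa [ENNReal.one_le_ofReal] using hz
    have hemp := hopen.eq_empty_of_measure_zero hnull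
    intro z
    by_contra! hz
    exact Set.eq_empty_iff_forall_notMem.1 hemp z hz
  have hz := hall z
  have hexp : Real.exp (‖z‖ ^ 2 - ‖A z + b‖ ^ 2) * Real.exp (‖A z + b‖ ^ 2 - ‖z‖ ^ 2) = 1 := by
    rw [← Real.exp_add, sub_add_sub_cancel, sub_self, Real.exp_zero]
  rw [one_div, inv_mul_le_iff₀ hdet]
  calc Real.exp (‖A z + b‖ ^ 2 - ‖z‖ ^ 2)
      ≤ g z * Real.exp (‖A z + b‖ ^ 2 - ‖z‖ ^ 2) := le_mul_of_one_le_left (Real.exp_pos _).le hz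
    _ = ‖A.det‖ ^ 2 * C := by
      rw [hg]
      simp only
      rw [mul_assoc, hexp]
      ring

/-- The image of an affine map with singular linear part is a null set. -/
lemma volume_range_affine_eq_zero (hφ : ∀ z, φ z = A z + b) (hA : A.det = 0) :
    (volume : Measure (Cd d)) (Set.range φ) = 0 := by
  let f : Cd d →ₗ[ℝ] Cd d := (A : Cd d →ₗ[ℂ] Cd d).restrictScalars ℝ
  have hf : LinearMap.det f = 0 := by
    have h : LinearMap.det (A : Cd d →ₗ[ℂ] Cd d) = 0 := hA
    rw [LinearMap.det_restrictScalars, h, Algebra.norm_complex_eq]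
    simp
  have h1 : (volume : Measure (Cd d)) (f '' Set.univ) = 0 := by
    rw [Measure.addHaar_image_linearMap, hf]
    simp
  have h2 : Set.range φ = (fun w => w + -b) ⁻¹' (f '' Set.univ) := by
    ext w
    simp only [Set.mem_range, Set.mem_preimage, Set.image_univ]
    refine exists_congr fun z => ?_
    rw [hφ, eq_add_neg_iff_add_eq]
    rfl
  rw [h2, measure_preimage_add_right, h1]

/-- Otherwise the range is a null set whose preimage is the whole space. -/
lemma det_ne_zero_of_quasiMeasurePreserving (hφ : ∀ z, φ z = A z + b)
    (hq : Measure.QuasiMeasurePreserving φ (gaussCd d) (gaussCd d)) : A.det ≠ 0 := by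
  intro h0
  have h1 := hq.preimage_null (gaussCd_absolutelyContinuous d (volume_range_affine_eq_zero hφ h0))
  rw [Set.preimage_range, measure_univ] at h1
  exact one_ne_zero h1

end AffineSymbol

/-! ### Norm estimates and the spectral radius. -/

lemma IsCompositionBy.pow {d : ℕ} {φ : Cd d → Cd d}
    (hq : Measure.QuasiMeasurePreserving φ (gaussCd d) (gaussCd d))
    {T : L2Gauss d →L[ℂ] L2Gauss d} (hT : IsCompositionBy T φ) (n : ℕ) :
    IsCompositionBy (T ^ n) φ^[n] := by
  induction n with
  | zero =>
    intro f
    rw [pow_zero, one_apply_eq_self, Function.iterate_zero, Function.comp_id]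
  | succ n ih =>
    intro f
    rw [pow_succ', mul_apply_eq_comp, Function.iterate_succ, ← Function.comp_assoc]
    exact (hT _).trans (hq.ae_eq_comp (ih f))

/-- Upper norm estimate for the composition operator with an affine symbol. -/
lemma IsCompositionBy.norm_sq_le_of_norm_sq_sub_le {d : ℕ} {φ : Cd d → Cd d}
    {A : Cd d →L[ℂ] Cd d} {b : Cd d} (hφ : ∀ z, φ z = A z + b) (hA : A.det ≠ 0)
    {T : L2Gauss d →L[ℂ] L2Gauss d} (hT : IsCompositionBy T φ) {s : ℝ}
    (hs : ∀ z, ‖φ z‖ ^ 2 - ‖z‖ ^ 2 ≤ s) : ‖T‖ ^ 2 ≤ 1 / ‖A.det‖ ^ 2 * Real.exp s := by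
  have hm : Measurable φ := by
    rw [funext hφ]
    fun_prop
  have h := hT.norm_sq_le hm (map_gaussCd_le_of_norm_sq_sub_le hφ hA hs)
  rwa [Real.coe_toNNReal _ (by positivity)] at h

lemma IsCompositionBy.le_norm_sq {d : ℕ} {φ : Cd d → Cd d}
    {A : Cd d →L[ℂ] Cd d} {b : Cd d} (hφ : ∀ z, φ z = A z + b) (hA : A.det ≠ 0)
    (hq : Measure.QuasiMeasurePreserving φ (gaussCd d) (gaussCd d))
    {T : L2Gauss d →L[ℂ] L2Gauss d} (hT : IsCompositionBy T φ) (z : Cd d) :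
    1 / ‖A.det‖ ^ 2 * Real.exp (‖φ z‖ ^ 2 - ‖z‖ ^ 2) ≤ ‖T‖ ^ 2 :=
  exp_le_of_map_gaussCd_le hφ hA (sq_nonneg _) (hT.map_le hq.measurable hq) z

lemma det_pow_continuousLinearMap {d : ℕ} (A : Cd d →L[ℂ] Cd d) (n : ℕ) :
    (A ^ n).det = A.det ^ n := by
  induction n with
  | zero => exact LinearMap.det_id
  | succ n ih =>
    rw [pow_succ, pow_succ, ← ih]
    exact LinearMap.det_comp _ _

/-- The spectral radius of a composition operator with contractive affine symbol. -/
lemma IsCompositionBy.spectralRadius_eq {d : ℕ} {φ : Cd d → Cd d}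
    {A : Cd d →L[ℂ] Cd d} {b c : Cd d} (hφ : ∀ z, φ z = A z + b) (hA : A.det ≠ 0) (hA1 : ‖A‖ ≤ 1)
    (hc : c - A (ContinuousLinearMap.adjoint A c) = b)
    (hq : Measure.QuasiMeasurePreserving φ (gaussCd d) (gaussCd d))
    {T : L2Gauss d →L[ℂ] L2Gauss d} (hT : IsCompositionBy T φ) :
    spectralRadius ℂ T = ENNReal.ofReal (1 / ‖A.det‖) := by
  have hlim := spectrum.pow_nnnorm_pow_one_div_tendsto_nhds_spectralRadius T
  have hcast : ∀ n : ℕ, ((‖T ^ n‖₊ : ENNReal) ^ (1 / (n : ℝ))) =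
      ENNReal.ofReal (‖T ^ n‖ ^ (1 / (n : ℝ))) := fun n => by
    rw [← ENNReal.ofReal_rpow_of_nonneg (norm_nonneg _) (by positivity), ofReal_norm,
      enorm_eq_nnnorm]
  simp only [hcast] at hlim
  have hit : ∀ n z, φ^[n] z = (A ^ n) z + φ^[n] 0 := fun n z => by
    simpa using iterate_affine hφ n z 0
  have hdet : ∀ n, (A ^ n).det ≠ 0 := fun n => by
    rw [det_pow_continuousLinearMap]
    exact pow_ne_zero _ hA
  have hpow : ∀ n : ℕ, 1 / ‖(A ^ n).det‖ ^ 2 = ((1 / ‖A.det‖) ^ n) ^ 2 := fun n => by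
    rw [det_pow_continuousLinearMap, norm_pow, div_pow, div_pow, one_pow, one_pow]
  have hroot : ∀ n : ℕ, n ≠ 0 → ((1 / ‖A.det‖) ^ n) ^ (1 / (n : ℝ)) = 1 / ‖A.det‖ := fun n hn => by
    rw [one_div (n : ℝ), Real.pow_rpow_inv_natCast (by positivity) hn]
  refine le_antisymm ?_ ?_
  · obtain ⟨N, C, hN, hC⟩ := exists_norm_iterate_sq_le hA1 hc hφ
    -- Gelfand's limit exists, so a subsequence suffices; k + 1 keeps the exponent nonzero.
    have hN' : Filter.Tendsto (fun k : ℕ => N * (k + 1)) Filter.atTop Filter.atTop :=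
      (Filter.tendsto_add_atTop_nat 1).const_mul_atTop' hN
    have hbound : ∀ k : ℕ, ‖T ^ (N * (k + 1))‖ ^ (1 / ((N * (k + 1) : ℕ) : ℝ)) ≤
        1 / ‖A.det‖ * Real.exp (C / 2 * (1 / ((N * (k + 1) : ℕ) : ℝ))) := by
      intro k
      set n := N * (k + 1) with hn
      have hn0 : n ≠ 0 := by positivity
      have h1 := (hT.pow hq n).norm_sq_le_of_norm_sq_sub_le (hit n) (hdet n) (hC (k + 1))
      have h2 : ‖T ^ n‖ ≤ (1 / ‖A.det‖) ^ n * Real.exp (C / 2) := by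
        refine abs_le_of_sq_le_sq' ?_ (by positivity) |>.2
        rwa [mul_pow, ← hpow, ← Real.exp_nat_mul, Nat.cast_ofNat, mul_div_cancel₀ C two_ne_zero]
      calc ‖T ^ n‖ ^ (1 / (n : ℝ))
          ≤ ((1 / ‖A.det‖) ^ n * Real.exp (C / 2)) ^ (1 / (n : ℝ)) := by gcongr
        _ = 1 / ‖A.det‖ * Real.exp (C / 2 * (1 / (n : ℝ))) := by
          rw [Real.mul_rpow (by positivity) (by positivity), hroot n hn0, Real.exp_mul]
    have hlim2 : Filter.Tendsto (fun k : ℕ => ENNReal.ofReal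
        (1 / ‖A.det‖ * Real.exp (C / 2 * (1 / ((N * (k + 1) : ℕ) : ℝ))))) Filter.atTop
        (nhds (ENNReal.ofReal (1 / ‖A.det‖))) := by
      refine ENNReal.tendsto_ofReal ?_
      have h1 : Filter.Tendsto (fun k : ℕ => C / 2 * (1 / ((N * (k + 1) : ℕ) : ℝ))) Filter.atTop
          (nhds 0) := by
        simpa using (tendsto_one_div_atTop_nhds_zero_nat.comp hN').const_mul (C / 2)
      simpa using ((Real.continuous_exp.tendsto 0).comp h1).const_mul (1 / ‖A.det‖)
    exact le_of_tendsto_of_tendsto' (hlim.comp hN') hlim2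
      fun k => ENNReal.ofReal_le_ofReal (hbound k)
  · refine ge_of_tendsto hlim ?_
    filter_upwards [Filter.eventually_ne_atTop 0] with n hn
    refine ENNReal.ofReal_le_ofReal ?_
    -- At the origin the exponent ‖φ^[n] 0‖² is nonnegative, leaving only the determinant.
    have h1 := (hT.pow hq n).le_norm_sq (hit n) (hdet n) (hq.iterate n) 0
    have h2 : (1 / ‖A.det‖) ^ n ≤ ‖T ^ n‖ := by
      refine abs_le_of_sq_le_sq' ?_ (norm_nonneg _) |>.2
      refine le_trans ?_ h1
      rw [hpow]
      refine le_mul_of_one_le_right (by positivity) (Real.one_le_exp ?_)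
      simp
    calc 1 / ‖A.det‖ = ((1 / ‖A.det‖) ^ n) ^ (1 / (n : ℝ)) := (hroot n hn).symm
      _ ≤ ‖T ^ n‖ ^ (1 / (n : ℝ)) := by gcongr

/-! ### The defect operator, its generalized inverse and the main theorem. -/

lemma defectOp_apply {d : ℕ} (A : Cd d →L[ℂ] Cd d) (x : Cd d) :
    defectOp A x = x - A (ContinuousLinearMap.adjoint A x) := rfl

lemma adjoint_defectOp {d : ℕ} (A : Cd d →L[ℂ] Cd d) :
    ContinuousLinearMap.adjoint (defectOp A) = defectOp A := by
  rw [← ContinuousLinearMap.star_eq_adjoint, defectOp, star_sub, star_one, star_mul,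
    ← ContinuousLinearMap.star_eq_adjoint, star_star]

/-- The generalized inverse of a selfadjoint operator solves the equation. -/
lemma apply_genInv {E : Type*} [NormedAddCommGroup E] [InnerProductSpace ℂ E]
    [FiniteDimensional ℂ E] [CompleteSpace E] {B : E →L[ℂ] E}
    (hB : ContinuousLinearMap.adjoint B = B) {b : E} (hb : b ∈ Set.range B) :
    B (genInv B b) = b := by
  have h : ∃ c ∈ closure (Set.range B), B c = b := by
    obtain ⟨c, rfl⟩ := hb
    -- For selfadjoint `B` the complement of the range is the kernel, so that component of a
    -- preimage can be dropped.
    obtain ⟨x, hx, y, hy, rfl⟩ :=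
      Submodule.exists_add_mem_mem_orthogonal (K := (B : E →ₗ[ℂ] E).range) c
    refine ⟨x, subset_closure hx, ?_⟩
    rw [ContinuousLinearMap.orthogonal_range, hB] at hy
    have hy' : B y = 0 := hy
    rw [map_add, hy', add_zero]
  rw [genInv, dif_pos h]
  exact h.choose_spec.2

theorem theorem13p1 (d : ℕ) (φ : Cd d → Cd d) (hφ : Differentiable ℂ φ) :
    ((CompWellDefined φ ∧ (compOp φ).domain = ⊤) ↔
      ∃ (A : Cd d →L[ℂ] Cd d) (b : Cd d), IsContractiveAffine φ A b) ∧
    ∀ (A : Cd d →L[ℂ] Cd d) (b : Cd d), IsContractiveAffine φ A b →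
      ∃ T : L2Gauss d →L[ℂ] L2Gauss d,
        (T : L2Gauss d →ₗ[ℂ] L2Gauss d).toPMap ⊤ = compOp φ ∧
        ((‖T‖ ^ 2 : ℝ) : ℂ) =
          1 / (‖A.det‖ : ℂ) ^ 2 * Complex.exp (inner ℂ b (genInv (defectOp A) b)) ∧
        spectralRadius ℂ T = ENNReal.ofReal (1 / ‖A.det‖) := by
  have hm : Measurable φ := hφ.continuous.measurable
  have hsup : ∀ {A : Cd d →L[ℂ] Cd d} {b : Cd d}, IsContractiveAffine φ A b →
      ∃ c, genInv (defectOp A) b = c ∧ c - A (ContinuousLinearMap.adjoint A c) = b ∧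
        ∀ z, ‖φ z‖ ^ 2 - ‖z‖ ^ 2 ≤ ‖c‖ ^ 2 - ‖ContinuousLinearMap.adjoint A c‖ ^ 2 := by
    rintro A b ⟨haff, -, hA1, hb⟩
    have hc := apply_genInv (adjoint_defectOp A) hb
    rw [defectOp_apply] at hc
    refine ⟨_, rfl, hc, fun z => ?_⟩
    rw [haff, norm_affine_sq_sub_norm_sq hc, sub_le_self_iff, sub_nonneg]
    gcongr
    exact norm_apply_le_of_norm_le_one hA1 _
  have hmap : ∀ {A : Cd d →L[ℂ] Cd d} {b : Cd d}, IsContractiveAffine φ A b →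
      ∃ C : NNReal, (gaussCd d).map φ ≤ (C : ENNReal) • gaussCd d := fun h => by
    obtain ⟨c, -, -, hs⟩ := hsup h
    exact ⟨_, map_gaussCd_le_of_norm_sq_sub_le h.1 h.2.1 hs⟩
  refine ⟨⟨?_, ?_⟩, ?_⟩
  · rintro ⟨hw, hd⟩
    have hq := quasiMeasurePreserving_of_compWellDefined hm hw
    obtain ⟨T, hT⟩ := exists_isCompositionBy_of_domain_eq_top hq hd
    obtain ⟨K, hK⟩ := exists_norm_sq_le_of_map_le hφ (hT.map_le hm hq)
    obtain ⟨A, b, hAb⟩ := exists_affine_of_norm_sq_le hφ hK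
    have hK' : ∀ z, ‖A z + b‖ ^ 2 ≤ ‖z‖ ^ 2 + K := fun z => hAb z ▸ hK z
    refine ⟨A, b, hAb, det_ne_zero_of_quasiMeasurePreserving hAb hq,
      norm_le_one_of_norm_sq_le hK',
      mem_range_of_isSelfAdjoint_of_inner_ker (adjoint_defectOp A) fun x hx => ?_⟩
    rw [defectOp_apply, sub_eq_zero] at hx
    exact inner_eq_zero_of_norm_sq_le hK' hx.symm
  · rintro ⟨A, b, h⟩
    obtain ⟨C, hC⟩ := hmap h
    have hq := quasiMeasurePreserving_of_map_le hm hC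
    obtain ⟨T, hT⟩ := exists_isCompositionBy hm hC
    refine ⟨compWellDefined_of_quasiMeasurePreserving hq, ?_⟩
    rw [← hT.toPMap_eq hq]
    rfl
  · intro A b h
    obtain ⟨C, hC⟩ := hmap h
    have hq := quasiMeasurePreserving_of_map_le hm hC
    obtain ⟨T, hT⟩ := exists_isCompositionBy hm hC
    obtain ⟨c, hgc, hc, hs⟩ := hsup h
    obtain ⟨haff, hdet, hA1, -⟩ := h
    refine ⟨T, hT.toPMap_eq hq, ?_, hT.spectralRadius_eq haff hdet hA1 hc hq⟩
    -- The upper bound for the exponent is attained at A*c, so the two norm estimates meet.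
    have hatt : ‖φ (ContinuousLinearMap.adjoint A c)‖ ^ 2 - ‖ContinuousLinearMap.adjoint A c‖ ^ 2 =
        ‖c‖ ^ 2 - ‖ContinuousLinearMap.adjoint A c‖ ^ 2 := by
      rw [haff, norm_affine_sq_sub_norm_sq hc]
      simp
    have hnorm : ‖T‖ ^ 2 = 1 / ‖A.det‖ ^ 2 *
        Real.exp (‖c‖ ^ 2 - ‖ContinuousLinearMap.adjoint A c‖ ^ 2) :=
      le_antisymm (hT.norm_sq_le_of_norm_sq_sub_le haff hdet hs)
        (hatt ▸ hT.le_norm_sq haff hdet hq (ContinuousLinearMap.adjoint A c))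
    rw [hnorm, hgc, inner_eq_norm_sq_sub_norm_adjoint_sq hc, Complex.ofReal_mul,
      Complex.ofReal_exp]
    push_cast
    rfl
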